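/- Let $q(x,y)=ax^2+bxy+cy^2$ ($a,b,c\in\mathbb{Z}$) be a primitive (that is, $\gcd(a,b,c)=1$) positive definite binary quadratic form of discriminant $b^2-4ac=-\Delta$. Suppose that $q$ lies in the principal genus, i.e. that $q$ is equivalent, over $\mathbb{Z}_p$ for every prime $p$ and over $\mathbb{R}$ (under invertible linear changes of variables), to the principal form of discriminant $-\Delta$, which is $x^2+\frac{\Delta}{4}y^2$ if $\Delta\equiv 0 \pmod 4$ and $x^2+xy+\frac{1+\Delta}{4}y^2$ if $\Delta\equiv 3\pmod 4$. Then there is a positive integer $N$ with $N\le \Delta^3$ and $\gcd(N,\Delta)=1$ such that $q$ primitively represents $N^2$, i.e. $q(x,y)=N^2$ for some coprime integers $x,y$. -/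

import Mathlib

/-- A binary quadratic form `[a, b, c] = a x² + b x y + c y²` with coefficients in `R`. -/
structure BinaryForm (R : Type*) where
  a : R
  b : R
  c : R

namespace BinaryForm

/-- The value `q(x, y) = a x² + b x y + c y²`. -/
def eval {R : Type*} [CommRing R] (q : BinaryForm R) (x y : R) : R :=
  q.a * x ^ 2 + q.b * x * y + q.c * y ^ 2

/-- The form `[a, b, c]` as a Mathlib quadratic form on the free module `R²`. -/
def toQuadraticForm {R : Type*} [CommRing R] (q : BinaryForm R) :
    QuadraticForm R (Fin 2 → R) :=
  Matrix.toQuadraticForm' !![q.a, q.b; 0, q.c]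

theorem toQuadraticForm_apply {R : Type*} [CommRing R] (q : BinaryForm R) (v : Fin 2 → R) :
    q.toQuadraticForm v = q.eval (v 0) (v 1) := by
  simp [toQuadraticForm, eval, Matrix.toQuadraticForm', Matrix.toLinearMap₂'_apply,
    Fin.sum_univ_two]
  ring

/-- The discriminant `b² - 4ac`. -/
def disc {R : Type*} [CommRing R] (q : BinaryForm R) : R :=
  q.b ^ 2 - 4 * q.a * q.c

/-- Extension of scalars along the canonical map `ℤ → R`. -/
def baseChange (R : Type*) [CommRing R] (q : BinaryForm ℤ) : BinaryForm R :=
  ⟨(q.a : R), (q.b : R), (q.c : R)⟩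

/-- The content: the gcd of the coefficients. -/
def content (q : BinaryForm ℤ) : ℕ :=
  Int.gcd q.a (Int.gcd q.b q.c)

/-- An integral form is primitive if its content is `1`. -/
def IsPrimitive (q : BinaryForm ℤ) : Prop :=
  q.content = 1

/-- Positive definiteness of an integral form: `q(x, y) > 0` for all `(x, y) ≠ (0, 0)`. -/
def PosDef (q : BinaryForm ℤ) : Prop :=
  q.toQuadraticForm.PosDef

/-- Two integral forms are equivalent over `R` if some invertible `R`-linear change of variables
(an element of `GL₂(R)`) transforms one into the other. -/
def EquivOver (R : Type*) [CommRing R] (q₁ q₂ : BinaryForm ℤ) : Prop :=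
  (q₁.baseChange R).toQuadraticForm.Equivalent (q₂.baseChange R).toQuadraticForm

/-- Genus equivalence: equivalence over `ℤ_p` for every prime `p`, and over `ℝ`. -/
def GenusEquiv (q₁ q₂ : BinaryForm ℤ) : Prop :=
  (∀ (p : ℕ) [Fact p.Prime], EquivOver ℤ_[p] q₁ q₂) ∧ EquivOver ℝ q₁ q₂

/-- The principal form of discriminant `D` (for `D ≡ 0, 1 mod 4`): `x² - (D/4) y²` if
`D ≡ 0 mod 4`, and `x² + x y + ((1 - D)/4) y²` if `D ≡ 1 mod 4`. -/
def principal (D : ℤ) : BinaryForm ℤ :=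
  if D % 4 = 0 then ⟨1, 0, -D / 4⟩ else ⟨1, 1, (1 - D) / 4⟩

/-- `q` lies in the principal genus: it is genus-equivalent to the principal form of its own
discriminant. -/
def InPrincipalGenus (q : BinaryForm ℤ) : Prop :=
  GenusEquiv q (principal q.disc)

/-- `q` primitively represents `n`: `n = q(x, y)` for some coprime integers `x`, `y`. -/
def PrimitivelyRepresents (q : BinaryForm ℤ) (n : ℤ) : Prop :=
  ∃ x y : ℤ, Int.gcd x y = 1 ∧ q.eval x y = n

end BinaryForm

namespace BinaryForm

/-! This is Gauss's argument that a class in the principal genus is a square, made effective. Local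
equivalence gives `u, v` with `q(u, v) ≡ 1` mod `Δ`, so `q` extends to an indefinite integral
ternary form of half-discriminant `-1`. Minkowski's theorem makes that form isotropic, and it splits
as `Y² - X Z`. Restricted to `q`, this gives `q(X, Y) = B² - A C`, a quarter of the discriminant of
`X Q₁ + Y Q₂`, where `Qᵢ = [Aᵢ, 2Bᵢ, Cᵢ]` (`exists_representation_of_one_mod_disc`).

At `(X, Y) = (Q₂(x, y), -Q₁(x, y))` the form `X Q₁ + Y Q₂` vanishes at `(x, y)`, so its discriminant
is a square; explicitly `q(Q₂, -Q₁) = f²`, with `f` the form of `2 × 2` minors of the `(Aᵢ, Bᵢ,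
Cᵢ)`. This `f` is primitive of discriminant `-Δ`. Reduction theory gives it a nonzero value coprime
to `Δ` with absolute value at most `Δ³` (`exists_small_coprime_value`), and that absolute value is
`N`. -/

theorem intGcd_eq_one_of_forall_prime {m n : ℤ}
    (h : ∀ p : ℕ, p.Prime → (p : ℤ) ∣ m → (p : ℤ) ∣ n → False) : Int.gcd m n = 1 :=
  Nat.coprime_of_dvd fun p hp hm hn =>
    h p hp (Int.natCast_dvd.2 hm) (Int.natCast_dvd.2 hn)

theorem exists_linearCombination_eq_one {k₁ k₂ k₃ : ℤ}
    (h : ∀ p : ℕ, p.Prime → (p : ℤ) ∣ k₁ → (p : ℤ) ∣ k₂ → (p : ℤ) ∣ k₃ → False) :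
    ∃ r s t : ℤ, k₁ * r + k₂ * s + k₃ * t = 1 := by
  have h1 : Int.gcd k₁ (Int.gcd k₂ k₃) = 1 := by
    refine intGcd_eq_one_of_forall_prime fun p hp h1 h2 => h p hp h1 ?_ ?_
    · exact h2.trans (Int.gcd_dvd_left ..)
    · exact h2.trans (Int.gcd_dvd_right ..)
  have h2 := Int.gcd_eq_gcd_ab k₁ (Int.gcd k₂ k₃)
  have h3 := Int.gcd_eq_gcd_ab k₂ k₃
  rw [h1] at h2
  refine ⟨Int.gcdA k₁ (Int.gcd k₂ k₃), Int.gcdB k₁ (Int.gcd k₂ k₃) * Int.gcdA k₂ k₃,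
    Int.gcdB k₁ (Int.gcd k₂ k₃) * Int.gcdB k₂ k₃, ?_⟩
  push_cast at h2
  linear_combination -h2 - Int.gcdB k₁ (Int.gcd k₂ k₃) * h3

/-! ### Ternary forms of half-discriminant `-1`: isotropy and splitting. -/

open MeasureTheory in
/-- Minkowski's theorem for three-dimensional ellipsoids. -/
theorem exists_int_sum_sq_mulVec_lt_one (A : Matrix (Fin 3) (Fin 3) ℝ) (h0 : A.det ≠ 0)
    (hA : |A.det| < Real.pi / 6) :
    ∃ v : Fin 3 → ℤ, v ≠ 0 ∧ ∑ i, (A.mulVec (fun j => (v j : ℝ)) i) ^ 2 < 1 := by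
  let b := Pi.basisFun ℝ (Fin 3)
  let F : (Fin 3 → ℝ) →ₗ[ℝ] EuclideanSpace ℝ (Fin 3) :=
    (WithLp.linearEquiv 2 ℝ (Fin 3 → ℝ)).symm.toLinearMap ∘ₗ Matrix.toLin' A
  let s : Set (Fin 3 → ℝ) := F ⁻¹' Metric.ball 0 1
  have hs : ∀ v : Fin 3 → ℝ, v ∈ s ↔ ∑ i, (A.mulVec v i) ^ 2 < 1 := by
    intro v
    simp only [s, Set.mem_preimage, mem_ball_zero_iff]
    rw [← sq_lt_one_iff₀ (norm_nonneg _), EuclideanSpace.norm_sq_eq]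
    simp [F]
  have hvol : volume s = ENNReal.ofReal (|A.det|⁻¹ * (Real.pi * 4 / 3)) := by
    have h1 : s = Matrix.toLin' A ⁻¹'
        (WithLp.toLp 2 ⁻¹' Metric.ball (0 : EuclideanSpace ℝ (Fin 3)) 1) := rfl
    rw [h1, Measure.addHaar_preimage_linearMap _ (by simpa using h0),
      (PiLp.volume_preserving_toLp (Fin 3)).measure_preimage
        measurableSet_ball.nullMeasurableSet, EuclideanSpace.volume_ball_fin_three]
    rw [ENNReal.ofReal_mul (by positivity)]
    simp [abs_inv]
  have hfund := ZSpan.isAddFundamentalDomain' b volume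
  have hconv : Convex ℝ s := (convex_ball _ _).is_linear_preimage F.isLinear
  have hsymm : ∀ x ∈ s, -x ∈ s := by
    intro x hx
    rw [hs] at hx ⊢
    simpa [Matrix.mulVec_neg] using hx
  have hlt : volume (ZSpan.fundamentalDomain b) * 2 ^ Module.finrank ℝ (Fin 3 → ℝ) < volume s := by
    rw [hvol, ZSpan.volume_fundamentalDomain]
    have h1 : (Matrix.of b).det = 1 := by
      have : Matrix.of b = (1 : Matrix (Fin 3) (Fin 3) ℝ) := by
        ext i j
        simp [b, Matrix.one_apply, Pi.single_apply, eq_comm]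
      rw [this, Matrix.det_one]
    -- The ellipsoid has volume `4π / (3 |det A|)`, which exceeds `2³` exactly when `|det A| < π /
    -- 6`.
    have h2 : (8 : ℝ) < |A.det|⁻¹ * (Real.pi * 4 / 3) := by
      rw [inv_mul_eq_div, lt_div_iff₀ (abs_pos.2 h0)]
      linarith
    rw [h1]
    simp only [abs_one, ENNReal.ofReal_one, one_mul, Module.finrank_fin_fun]
    refine lt_of_eq_of_lt ?_ (ENNReal.ofReal_lt_ofReal_iff (by linarith) |>.2 h2)
    norm_num
  have : Countable (Submodule.span ℤ (Set.range b)).toAddSubgroup :=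
    inferInstanceAs (Countable (Submodule.span ℤ (Set.range b)))
  obtain ⟨⟨x, hxL⟩, hx0, hx⟩ :=
    exists_ne_zero_mem_lattice_of_measure_mul_two_pow_lt_measure hfund hsymm hconv hlt
  have hxL' : x ∈ Submodule.span ℤ (Set.range b) := hxL
  rw [b.mem_span_iff_repr_mem ℤ] at hxL'
  choose v hv using hxL'
  have hvx : (fun j => (v j : ℝ)) = x := by
    ext j
    simpa [b] using hv j
  refine ⟨v, ?_, ?_⟩
  · rintro rfl
    apply hx0
    ext j
    simp [← hvx]
  · rw [hvx]
    exact (hs x).1 hx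

/-- A hyperbolic pair `v, w` in a ternary lattice of half-discriminant `-1` splits the form as
`X Z + Y²`; restricting to a coordinate plane this represents a binary form by `X Z + Y²`. -/
theorem exists_representation_of_hyperbolicPair {a b c e h g x y z r s t : ℤ}
    (hd : 4 * a * c * g + b * e * h - a * h ^ 2 - c * e ^ 2 - g * b ^ 2 = -1)
    (hv : a * x ^ 2 + b * x * y + c * y ^ 2 + z * (e * x + h * y) + g * z ^ 2 = 0)
    (hw : a * r ^ 2 + b * r * s + c * s ^ 2 + t * (e * r + h * s) + g * t ^ 2 = 0)
    (hvw : (2 * a * x + b * y + e * z) * r + (b * x + 2 * c * y + h * z) * s +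
      (e * x + h * y + 2 * g * z) * t = 1) :
    ∃ A₁ B₁ C₁ A₂ B₂ C₂ : ℤ, a = B₁ ^ 2 - A₁ * C₁ ∧ b = 2 * B₁ * B₂ - A₁ * C₂ - A₂ * C₁ ∧
      c = B₂ ^ 2 - A₂ * C₂ ∧
      ∃ l m n : ℤ, l * (A₁ * B₂ - A₂ * B₁) + m * (A₁ * C₂ - A₂ * C₁) +
        n * (B₁ * C₂ - B₂ * C₁) = 1 := by
  have key : ∀ X Y : ℤ, a * X ^ 2 + b * X * Y + c * Y ^ 2 =
      ((y * t - z * s) * X + (z * r - x * t) * Y) ^ 2 +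
      ((2 * a * r + b * s + e * t) * X + (b * r + 2 * c * s + h * t) * Y) *
      ((2 * a * x + b * y + e * z) * X + (b * x + 2 * c * y + h * z) * Y) := by
    intro X Y
    obtain ⟨N, hN⟩ : ∃ N, N = (y * t - z * s) * X + (z * r - x * t) * Y := ⟨_, rfl⟩
    obtain ⟨α, hα⟩ : ∃ α, α =
      (2 * a * r + b * s + e * t) * X + (b * r + 2 * c * s + h * t) * Y := ⟨_, rfl⟩
    obtain ⟨β, hβ⟩ : ∃ β, β =
      (2 * a * x + b * y + e * z) * X + (b * x + 2 * c * y + h * z) * Y := ⟨_, rfl⟩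
    obtain ⟨T, hT⟩ : ∃ T, T = a * X ^ 2 + b * X * Y + c * Y ^ 2 := ⟨_, rfl⟩
    -- The Gram determinant of `(x, y, z)`, `(r, s, t)`, `(X, Y, 0)` is that of the ternary form
    -- times `N²`, since `N` is the determinant of the three vectors.
    have gram : 2 * (a * x ^ 2 + b * x * y + c * y ^ 2 + z * (e * x + h * y) + g * z ^ 2) *
        (4 * (a * r ^ 2 + b * r * s + c * s ^ 2 + t * (e * r + h * s) + g * t ^ 2) * T - α ^ 2) -
        ((2 * a * x + b * y + e * z) * r + (b * x + 2 * c * y + h * z) * s +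
          (e * x + h * y + 2 * g * z) * t) *
        (2 * ((2 * a * x + b * y + e * z) * r + (b * x + 2 * c * y + h * z) * s +
          (e * x + h * y + 2 * g * z) * t) * T - α * β) +
        β * (((2 * a * x + b * y + e * z) * r + (b * x + 2 * c * y + h * z) * s +
          (e * x + h * y + 2 * g * z) * t) * α -
          2 * (a * r ^ 2 + b * r * s + c * s ^ 2 + t * (e * r + h * s) + g * t ^ 2) * β) =
        2 * (4 * a * c * g + b * e * h - a * h ^ 2 - c * e ^ 2 - g * b ^ 2) * N ^ 2 := by
      rw [hN, hα, hβ, hT]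
      ring
    rw [hd, hv, hw, hvw] at gram
    rw [← hN, ← hα, ← hβ, ← hT]
    linarith
  have k1 := key 1 0
  have k2 := key 0 1
  have k3 := key 1 1
  -- `(Aᵢ, Bᵢ, Cᵢ)` are the hyperbolic coordinates of the first two basis vectors. Those of the
  -- third give `l, m, n`, by expanding the determinant `1` of the coordinate change.
  refine ⟨-(2 * a * r + b * s + e * t), y * t - z * s, 2 * a * x + b * y + e * z,
    -(b * r + 2 * c * s + h * t), z * r - x * t, b * x + 2 * c * y + h * z,
    by linear_combination k1, by linear_combination k3 - k1 - k2, by linear_combination k2,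
    e * x + h * y + 2 * g * z, -(x * s - y * r), -(e * r + h * s + 2 * g * t), ?_⟩
  have det : (e * x + h * y + 2 * g * z) * (-(2 * a * r + b * s + e * t) * (z * r - x * t) -
      -(b * r + 2 * c * s + h * t) * (y * t - z * s)) +
      -(x * s - y * r) * (-(2 * a * r + b * s + e * t) * (b * x + 2 * c * y + h * z) -
      -(b * r + 2 * c * s + h * t) * (2 * a * x + b * y + e * z)) +
      -(e * r + h * s + 2 * g * t) * ((y * t - z * s) * (b * x + 2 * c * y + h * z) -
      (z * r - x * t) * (2 * a * x + b * y + e * z)) =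
      ((2 * a * x + b * y + e * z) * r + (b * x + 2 * c * y + h * z) * s +
      (e * x + h * y + 2 * g * z) * t) ^ 2 -
      4 * (a * x ^ 2 + b * x * y + c * y ^ 2 + z * (e * x + h * y) + g * z ^ 2) *
      (a * r ^ 2 + b * r * s + c * s ^ 2 + t * (e * r + h * s) + g * t ^ 2) := by
    ring
  rw [det, hv, hw, hvw]
  ring

/-- Mod 2 the polar form is alternating with radical spanned by `(h, e, b)`, where the quadratic
form takes the value `1`; so the radical has no nonzero isotropic vector. -/
theorem zmod_two_eq_zero_of_isotropic : ∀ a b c e h g x y z : ZMod 2,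
    b * e * h - a * h ^ 2 - c * e ^ 2 - g * b ^ 2 = -1 →
    a * x ^ 2 + b * x * y + c * y ^ 2 + z * (e * x + h * y) + g * z ^ 2 = 0 →
    b * y + e * z = 0 → b * x + h * z = 0 → e * x + h * y = 0 → x = 0 ∧ y = 0 ∧ z = 0 := by
  decide

/-- An indefinite ternary form of half-discriminant `-1` extending a positive definite binary
form is isotropic. -/
theorem exists_isotropic_of_halfDisc_eq_neg_one {a b c e h g : ℤ} (ha : 0 < a)
    (hΔ : 0 < 4 * a * c - b ^ 2)
    (hd : 4 * a * c * g + b * e * h - a * h ^ 2 - c * e ^ 2 - g * b ^ 2 = -1) :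
    ∃ v : Fin 3 → ℤ, v ≠ 0 ∧ a * v 0 ^ 2 + b * v 0 * v 1 + c * v 1 ^ 2 +
      v 2 * (e * v 0 + h * v 1) + g * v 2 ^ 2 = 0 := by
  have haR : (0 : ℝ) < a := by exact_mod_cast ha
  have hΔR : (0 : ℝ) < 4 * a * c - b ^ 2 := by exact_mod_cast hΔ
  have hdR : (4 : ℝ) * a * c * g + b * e * h - a * h ^ 2 - c * e ^ 2 - g * b ^ 2 = -1 := by
    exact_mod_cast hd
  obtain ⟨α, hα, hαa⟩ : ∃ α : ℝ, 0 < α ∧ α ^ 2 = a :=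
    ⟨√a, Real.sqrt_pos.2 haR, Real.sq_sqrt haR.le⟩
  obtain ⟨δ, hδ, hδΔ⟩ : ∃ δ : ℝ, 0 < δ ∧ δ ^ 2 = 4 * a * c - b ^ 2 :=
    ⟨_, Real.sqrt_pos.2 hΔR, Real.sq_sqrt hΔR.le⟩
  -- The rows complete the square, so that the ternary form is `L₁² + L₂² - L₃²`; half-discriminant
  -- `-1` makes the last coefficient `-1 / δ²`.
  let M : Matrix (Fin 3) (Fin 3) ℝ :=
    !![α, b / (2 * α), e / (2 * α); 0, δ / (2 * α), (2 * a * h - b * e) / (2 * α * δ);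
      0, 0, 1 / δ]
  have hM : M.det = 1 / 2 := by
    simp only [M, Matrix.det_fin_three, Matrix.of_apply, Matrix.cons_val', Matrix.cons_val_zero,
      Matrix.cons_val_one, Matrix.cons_val]
    field_simp
    ring
  obtain ⟨v, hv0, hv⟩ := exists_int_sum_sq_mulVec_lt_one M (by rw [hM]; norm_num) (by
    rw [hM, abs_of_pos (by norm_num)]
    linarith [Real.pi_gt_three])
  refine ⟨v, hv0, ?_⟩
  obtain ⟨T, hT⟩ : ∃ T : ℤ, T = a * v 0 ^ 2 + b * v 0 * v 1 + c * v 1 ^ 2 +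
      v 2 * (e * v 0 + h * v 1) + g * v 2 ^ 2 := ⟨_, rfl⟩
  rw [← hT]
  have hTR : (T : ℝ) = a * v 0 ^ 2 + b * v 0 * v 1 + c * v 1 ^ 2 +
      v 2 * (e * v 0 + h * v 1) + g * v 2 ^ 2 := by exact_mod_cast hT
  simp only [M, Matrix.mulVec, dotProduct, Fin.sum_univ_three, Matrix.of_apply, Matrix.cons_val',
    Matrix.cons_val_zero, Matrix.cons_val_one, Matrix.cons_val] at hv
  obtain ⟨L₁, h₁⟩ : ∃ L, L = α * v 0 + b / (2 * α) * v 1 + e / (2 * α) * v 2 := ⟨_, rfl⟩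
  obtain ⟨L₂, h₂⟩ : ∃ L, L = 0 * v 0 + δ / (2 * α) * v 1 +
    (2 * a * h - b * e) / (2 * α * δ) * v 2 := ⟨_, rfl⟩
  obtain ⟨L₃, h₃⟩ : ∃ L, L = 0 * v 0 + 0 * v 1 + 1 / δ * v 2 := ⟨_, rfl⟩
  rw [← h₁, ← h₂, ← h₃] at hv
  have e₁ : 2 * α * L₁ = 2 * a * v 0 + b * v 1 + e * v 2 := by
    rw [h₁, ← hαa]
    field_simp
  have e₂ : 2 * α * δ * L₂ = δ ^ 2 * v 1 + (2 * a * h - b * e) * v 2 := by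
    rw [h₂]
    field_simp
    ring
  have e₃ : δ * L₃ = v 2 := by
    rw [h₃]
    field_simp
    ring
  have hsig : (T : ℝ) = L₁ ^ 2 + L₂ ^ 2 - L₃ ^ 2 := by
    have h4 : (4 * α ^ 2 * δ ^ 2) * (T : ℝ) = (4 * α ^ 2 * δ ^ 2) * (L₁ ^ 2 + L₂ ^ 2 - L₃ ^ 2) := by
      have : (4 * α ^ 2 * δ ^ 2) * (L₁ ^ 2 + L₂ ^ 2 - L₃ ^ 2) =
          δ ^ 2 * (2 * α * L₁) ^ 2 + (2 * α * δ * L₂) ^ 2 - 4 * α ^ 2 * (δ * L₃) ^ 2 := by ring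
      rw [this, e₁, e₂, e₃, hTR, hδΔ, hαa]
      linear_combination (4 * a * (v 2 : ℝ) ^ 2) * hdR
    exact mul_left_cancel₀ (by positivity) h4
  -- `|T| ≤ L₁² + L₂² + L₃² < 1`, and `T` is an integer.
  have hlt : (T : ℝ) < 1 := by nlinarith [sq_nonneg L₃]
  have hgt : (-1 : ℝ) < T := by nlinarith [sq_nonneg L₁, sq_nonneg L₂]
  have hlt' : T < 1 := by exact_mod_cast hlt
  have hgt' : -1 < T := by exact_mod_cast hgt
  omega

/-- A primitive isotropic vector of a ternary form of half-discriminant `-1` is part of a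
hyperbolic pair. -/
theorem exists_hyperbolicPair_of_isotropic {a b c e h g x y z : ℤ}
    (hd : 4 * a * c * g + b * e * h - a * h ^ 2 - c * e ^ 2 - g * b ^ 2 = -1)
    (hv : a * x ^ 2 + b * x * y + c * y ^ 2 + z * (e * x + h * y) + g * z ^ 2 = 0)
    (hprim : ∀ p : ℕ, p.Prime → (p : ℤ) ∣ x → (p : ℤ) ∣ y → (p : ℤ) ∣ z → False) :
    ∃ r s t : ℤ, a * r ^ 2 + b * r * s + c * s ^ 2 + t * (e * r + h * s) + g * t ^ 2 = 0 ∧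
      (2 * a * x + b * y + e * z) * r + (b * x + 2 * c * y + h * z) * s +
      (e * x + h * y + 2 * g * z) * t = 1 := by
  obtain ⟨r, s, t, hrst⟩ : ∃ r s t : ℤ, (2 * a * x + b * y + e * z) * r +
      (b * x + 2 * c * y + h * z) * s + (e * x + h * y + 2 * g * z) * t = 1 := by
    refine exists_linearCombination_eq_one fun p hp h1 h2 h3 => ?_
    obtain ⟨k₁, hk₁⟩ := id h1
    obtain ⟨k₂, hk₂⟩ := id h2
    obtain ⟨k₃, hk₃⟩ := id h3
    -- The Gram matrix has determinant `-2`; multiplying by its adjugate recovers `2 * (x, y, z)`.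
    -- The prime `2` needs separate treatment.
    have hx : (p : ℤ) ∣ 2 * x :=
      ⟨-(4 * c * g - h ^ 2) * k₁ - (e * h - 2 * b * g) * k₂ - (b * h - 2 * c * e) * k₃, by
        linear_combination (2 * x) * hd - (4 * c * g - h ^ 2) * hk₁ -
          (e * h - 2 * b * g) * hk₂ - (b * h - 2 * c * e) * hk₃⟩
    have hy : (p : ℤ) ∣ 2 * y :=
      ⟨-(e * h - 2 * b * g) * k₁ - (4 * a * g - e ^ 2) * k₂ - (b * e - 2 * a * h) * k₃, by
        linear_combination (2 * y) * hd - (e * h - 2 * b * g) * hk₁ -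
          (4 * a * g - e ^ 2) * hk₂ - (b * e - 2 * a * h) * hk₃⟩
    have hz : (p : ℤ) ∣ 2 * z :=
      ⟨-(b * h - 2 * c * e) * k₁ - (b * e - 2 * a * h) * k₂ - (4 * a * c - b ^ 2) * k₃, by
        linear_combination (2 * z) * hd - (b * h - 2 * c * e) * hk₁ -
          (b * e - 2 * a * h) * hk₂ - (4 * a * c - b ^ 2) * hk₃⟩
    have hpI := Nat.prime_iff_prime_int.1 hp
    by_cases hp2 : (p : ℤ) ∣ 2
    · obtain rfl : p = 2 := (Nat.prime_dvd_prime_iff_eq hp Nat.prime_two).1 (by exact_mod_cast hp2)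
      have two : (2 : ZMod 2) = 0 := rfl
      have four : (4 : ZMod 2) = 0 := rfl
      have hdZ := congrArg (Int.cast : ℤ → ZMod 2) hd
      have hvZ := congrArg (Int.cast : ℤ → ZMod 2) hv
      rw [← ZMod.intCast_zmod_eq_zero_iff_dvd _ 2] at h1 h2 h3
      push_cast at hdZ hvZ h1 h2 h3
      simp only [two, four, zero_mul, zero_add, add_zero] at hdZ hvZ h1 h2 h3
      obtain ⟨q1, q2, q3⟩ := zmod_two_eq_zero_of_isotropic a b c e h g x y z hdZ hvZ h1 h2 h3
      rw [ZMod.intCast_zmod_eq_zero_iff_dvd] at q1 q2 q3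
      exact hprim 2 hp q1 q2 q3
    · exact hprim p hp ((hpI.dvd_or_dvd hx).resolve_left hp2)
        ((hpI.dvd_or_dvd hy).resolve_left hp2) ((hpI.dvd_or_dvd hz).resolve_left hp2)
  obtain ⟨m, hm⟩ : ∃ m, m =
    a * r ^ 2 + b * r * s + c * s ^ 2 + t * (e * r + h * s) + g * t ^ 2 := ⟨_, rfl⟩
  -- Subtracting `m` times the isotropic vector kills the value `m` and keeps the pairing equal to
  -- `1`.
  refine ⟨r - m * x, s - m * y, t - m * z, ?_, ?_⟩
  · linear_combination m ^ 2 * hv - m * hrst - hm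
  · linear_combination hrst - 2 * m * hv

/-- A positive definite binary form representing `1` modulo its discriminant is represented by
the ternary form `Y² - X Z`, with a primitive orthogonal complement. -/
theorem exists_representation_of_one_mod_disc {a b c u v : ℤ} (ha : 0 < a)
    (hΔ : 0 < 4 * a * c - b ^ 2)
    (huv : 4 * a * c - b ^ 2 ∣ a * u ^ 2 + b * u * v + c * v ^ 2 - 1) :
    ∃ A₁ B₁ C₁ A₂ B₂ C₂ : ℤ, a = B₁ ^ 2 - A₁ * C₁ ∧ b = 2 * B₁ * B₂ - A₁ * C₂ - A₂ * C₁ ∧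
      c = B₂ ^ 2 - A₂ * C₂ ∧
      ∃ l m n : ℤ, l * (A₁ * B₂ - A₂ * B₁) + m * (A₁ * C₂ - A₂ * C₁) +
        n * (B₁ * C₂ - B₂ * C₁) = 1 := by
  obtain ⟨g, hg⟩ := huv
  -- With `e = -v`, `h = u` the half-discriminant is `(4ac - b²) g - q(u, v)`.
  have hd : 4 * a * c * g + b * (-v) * u - a * u ^ 2 - c * (-v) ^ 2 - g * b ^ 2 = -1 := by
    linear_combination -hg
  obtain ⟨w, hw0, hw⟩ := exists_isotropic_of_halfDisc_eq_neg_one ha hΔ hd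
  obtain ⟨w', hw', hgcd⟩ := Finset.extract_gcd w (Finset.univ_nonempty (α := Fin 3))
  have hgcd0 : Finset.univ.gcd w ≠ 0 := by
    intro h0
    rw [Finset.gcd_eq_zero_iff] at h0
    exact hw0 (funext fun i => h0 i (Finset.mem_univ i))
  have hiso : a * w' 0 ^ 2 + b * w' 0 * w' 1 + c * w' 1 ^ 2 +
      w' 2 * (-v * w' 0 + u * w' 1) + g * w' 2 ^ 2 = 0 := by
    rw [hw' 0 (Finset.mem_univ _), hw' 1 (Finset.mem_univ _), hw' 2 (Finset.mem_univ _)] at hw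
    refine (mul_eq_zero.1 ?_).resolve_left (pow_ne_zero 2 hgcd0)
    linear_combination hw
  obtain ⟨r, s, t, h1, h2⟩ := exists_hyperbolicPair_of_isotropic hd hiso (by
    intro p hp h0 h1 h2
    have : (p : ℤ) ∣ Finset.univ.gcd w' := Finset.dvd_gcd fun i _ => by
      fin_cases i <;> assumption
    rw [hgcd] at this
    exact (Nat.prime_iff_prime_int.1 hp).not_dvd_one this)
  exact exists_representation_of_hyperbolicPair hd hiso h1 h2

/-! ### From the principal genus to the value `1` modulo `n`. -/

theorem baseChange_eval_one_zero_principal {R : Type*} [CommRing R] (D : ℤ) :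
    ((principal D).baseChange R).eval 1 0 = 1 := by
  unfold principal
  split_ifs <;> simp [baseChange, eval]

theorem EquivOver.exists_eval_eq_one {R : Type*} [CommRing R] {q : BinaryForm ℤ} {D : ℤ}
    (h : EquivOver R q (principal D)) : ∃ u v : R, (q.baseChange R).eval u v = 1 := by
  obtain ⟨φ⟩ := h
  refine ⟨φ.symm ![1, 0] 0, φ.symm ![1, 0] 1, ?_⟩
  rw [← toQuadraticForm_apply, QuadraticMap.IsometryEquiv.map_app, toQuadraticForm_apply]
  exact baseChange_eval_one_zero_principal D

theorem exists_eval_one_modEq_prime_pow {q : BinaryForm ℤ} (h : q.InPrincipalGenus) {p : ℕ}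
    (hp : p.Prime) (n : ℕ) : ∃ u v : ℤ, ((p ^ n : ℕ) : ℤ) ∣ q.eval u v - 1 := by
  have := Fact.mk hp
  obtain ⟨u, v, huv⟩ := (h.1 p).exists_eval_eq_one
  obtain ⟨u', hu'⟩ := ZMod.intCast_surjective (PadicInt.toZModPow n u)
  obtain ⟨v', hv'⟩ := ZMod.intCast_surjective (PadicInt.toZModPow n v)
  refine ⟨u', v', ?_⟩
  rw [← ZMod.intCast_zmod_eq_zero_iff_dvd]
  have := congrArg (PadicInt.toZModPow n) huv
  simp only [eval, baseChange, map_add, map_mul, map_pow, map_intCast, map_one] at this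
  simp only [eval]
  push_cast
  rw [hu', hv', this, sub_self]

theorem exists_eval_one_modEq {q : BinaryForm ℤ} (h : q.InPrincipalGenus) {n : ℕ} (hn : n ≠ 0) :
    ∃ u v : ℤ, (n : ℤ) ∣ q.eval u v - 1 := by
  induction n using Nat.recOnPosPrimePosCoprime with
  | zero => exact absurd rfl hn
  | one => exact ⟨0, 0, by simp⟩
  | prime_pow p n hp _ => exact exists_eval_one_modEq_prime_pow h hp n
  | coprime m n hm hn' hmn ihm ihn =>
    obtain ⟨u₁, v₁, h₁⟩ := ihm (by omega)
    obtain ⟨u₂, v₂, h₂⟩ := ihn (by omega)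
    obtain ⟨r, s, hrs⟩ := Nat.isCoprime_iff_coprime.2 hmn
    obtain ⟨k₁, hk₁⟩ := h₁
    obtain ⟨k₂, hk₂⟩ := h₂
    refine ⟨u₁ + r * m * (u₂ - u₁), v₁ + r * m * (v₂ - v₁), ?_⟩
    push_cast
    refine (Nat.isCoprime_iff_coprime.2 hmn).mul_dvd ?_ ?_
    · have : q.eval (u₁ + r * m * (u₂ - u₁)) (v₁ + r * m * (v₂ - v₁)) - 1 =
          (q.eval u₁ v₁ - 1) + m * (q.a * (2 * u₁ + r * m * (u₂ - u₁)) * r * (u₂ - u₁) +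
          q.b * (r * (u₂ - u₁) * v₁ + u₁ * r * (v₂ - v₁) + r * m * (u₂ - u₁) * r * (v₂ - v₁)) +
          q.c * (2 * v₁ + r * m * (v₂ - v₁)) * r * (v₂ - v₁)) := by
        simp only [eval]
        ring
      rw [this, hk₁]
      exact (dvd_mul_right _ _).add (dvd_mul_right _ _)
    · have hu : u₁ + r * m * (u₂ - u₁) = u₂ + n * (s * (u₁ - u₂)) := by
        linear_combination (u₂ - u₁) * hrs
      have hv : v₁ + r * m * (v₂ - v₁) = v₂ + n * (s * (v₁ - v₂)) := by
        linear_combination (v₂ - v₁) * hrs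
      have : ∀ X Y : ℤ, q.eval (u₂ + n * X) (v₂ + n * Y) - 1 =
          (q.eval u₂ v₂ - 1) + n * (q.a * (2 * u₂ + n * X) * X +
          q.b * (X * v₂ + u₂ * Y + n * X * Y) + q.c * (2 * v₂ + n * Y) * Y) := by
        intro X Y
        simp only [eval]
        ring
      rw [hu, hv, this, hk₂]
      exact (dvd_mul_right _ _).add (dvd_mul_right _ _)

/-! ### Reduction and small values coprime to the discriminant. -/

theorem PosDef.a_pos {q : BinaryForm ℤ} (h : q.PosDef) : 0 < q.a := by
  have := h ![1, 0] (by simp)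
  rw [toQuadraticForm_apply] at this
  simpa [eval] using this

theorem PosDef.disc_neg {q : BinaryForm ℤ} (h : q.PosDef) : q.disc < 0 := by
  have ha := h.a_pos
  have := h ![-q.b, 2 * q.a] (by
    intro h0
    have := congrFun h0 1
    simp at this
    omega)
  rw [toQuadraticForm_apply] at this
  simp only [eval, Matrix.cons_val_zero, Matrix.cons_val_one] at this
  have h2 : 0 < q.a * -q.disc := by
    simp only [disc]
    linarith
  have := pos_of_mul_pos_right h2 ha.le
  linarith

/-- Every positive definite binary form is properly equivalent to a reduced one. -/
theorem exists_reduced {q : BinaryForm ℤ} (ha : 0 < q.a) (hΔ : q.disc < 0) :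
    ∃ s t u v : ℤ, s * v - t * u = 1 ∧ ∃ g : BinaryForm ℤ, 0 < g.a ∧ |g.b| ≤ g.a ∧ g.a ≤ g.c ∧
      g.disc = q.disc ∧ ∀ x y, g.eval x y = q.eval (s * x + t * y) (u * x + v * y) := by
  have hpos : ∀ x y : ℤ, Int.gcd x y = 1 → 0 < q.eval x y := by
    intro x y hxy
    have h1 : 4 * q.a * q.eval x y = (2 * q.a * x + q.b * y) ^ 2 - q.disc * y ^ 2 := by
      simp only [eval, disc]
      ring
    have h2 : 0 < 4 * q.a * q.eval x y := by
      rw [h1]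
      by_cases hy : y = 0
      · subst hy
        have hx : x ≠ 0 := by
          rintro rfl
          simp at hxy
        have : 0 < (2 * q.a * x + q.b * 0) ^ 2 := by
          rw [mul_zero, add_zero]
          positivity
        linarith
      · have : 0 < -q.disc * y ^ 2 := mul_pos (by linarith) (by positivity)
        nlinarith [sq_nonneg (2 * q.a * x + q.b * y)]
    exact pos_of_mul_pos_right h2 (by linarith)
  have hex : ∃ n : ℕ, ∃ x y : ℤ, Int.gcd x y = 1 ∧ q.eval x y = n :=
    ⟨(q.eval 1 0).toNat, 1, 0, by simp, by rw [Int.toNat_of_nonneg (hpos 1 0 (by simp)).le]⟩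
  classical
  -- The least value at coprime arguments becomes the leading coefficient, which forces `g.a ≤ g.c`.
  obtain ⟨s, u, hsu, hN⟩ := Nat.find_spec hex
  have hmin : ∀ x y : ℤ, Int.gcd x y = 1 → q.eval s u ≤ q.eval x y := by
    intro x y hxy
    have := Nat.find_min' hex ⟨x, y, hxy, (Int.toNat_of_nonneg (hpos x y hxy).le).symm⟩
    have h2 := Int.toNat_of_nonneg (hpos x y hxy).le
    rw [hN]
    omega
  obtain ⟨v₀, t₀, hst⟩ := Int.isCoprime_iff_gcd_eq_one.2 hsu
  obtain ⟨a', ha'⟩ : ∃ a', a' = q.eval s u := ⟨_, rfl⟩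
  obtain ⟨b₀, hb₀⟩ : ∃ b₀, b₀ = 2 * q.a * s * (-t₀) + q.b * (s * v₀ + (-t₀) * u) +
    2 * q.c * u * v₀ := ⟨_, rfl⟩
  have ha'pos : 0 < a' := ha' ▸ hpos s u hsu
  obtain ⟨k, hk⟩ : ∃ k : ℤ, |b₀ + 2 * a' * k| ≤ a' := by
    refine ⟨-((b₀ + a') / (2 * a')), ?_⟩
    have h1 := Int.emod_add_mul_ediv (b₀ + a') (2 * a')
    have h2 := Int.emod_nonneg (b₀ + a') (by omega : 2 * a' ≠ 0)
    have h3 := Int.emod_lt_of_pos (b₀ + a') (by omega : 0 < 2 * a')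
    rw [abs_le]
    constructor <;> linarith
  have hdet : s * (v₀ + k * u) - (-t₀ + k * s) * u = 1 := by linear_combination hst
  refine ⟨s, -t₀ + k * s, u, v₀ + k * u, hdet,
    ⟨a', b₀ + 2 * a' * k, q.eval (-t₀ + k * s) (v₀ + k * u)⟩, ha'pos, hk, ?_, ?_, ?_⟩
  · rw [ha']
    refine hmin _ _ (Int.isCoprime_iff_gcd_eq_one.1 ⟨-u, s, ?_⟩)
    linear_combination hdet
  · have : (BinaryForm.mk a' (b₀ + 2 * a' * k) (q.eval (-t₀ + k * s) (v₀ + k * u))).disc =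
        q.disc * (s * (v₀ + k * u) - (-t₀ + k * s) * u) ^ 2 := by
      simp only [ha', hb₀, disc, eval]
      ring
    rw [this, hdet]
    ring
  · intro x y
    simp only [ha', hb₀, eval]
    ring

/-- For each prime dividing `D`, at least one of `f(1,0)`, `f(0,1)`, `f(1,1)` is a unit, so a
suitable choice of divisors `x, y` of `D` makes `f(x, y)` coprime to `D`. -/
theorem exists_coprime_eval {f : BinaryForm ℤ} {D : ℕ} (hD : D ≠ 0)
    (hf : ∀ p : ℕ, p.Prime → (p : ℤ) ∣ f.a → (p : ℤ) ∣ f.b → (p : ℤ) ∣ f.c → False) :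
    ∃ x y : ℕ, 0 < x ∧ 0 < y ∧ x * y ≤ D ∧ Nat.Coprime x y ∧ Int.gcd (f.eval x y) D = 1 := by
  classical
  -- Primes of `D` not dividing `f.a` go into `y`, those dividing `f.a` but not `f.c` into `x`.
  -- Those dividing both go into neither, leaving the unit `f.b * x * y`.
  let U := D.primeFactors.filter fun p : ℕ => (p : ℤ) ∣ f.a
  let S := U.filter fun p : ℕ => ¬ (p : ℤ) ∣ f.c
  let W := D.primeFactors.filter fun p : ℕ => ¬ (p : ℤ) ∣ f.a
  have hS : ∀ p ∈ S, p.Prime := fun p hp =>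
    Nat.prime_of_mem_primeFactors (Finset.mem_filter.1 (Finset.mem_filter.1 hp).1).1
  have hW : ∀ p ∈ W, p.Prime := fun p hp =>
    Nat.prime_of_mem_primeFactors (Finset.mem_filter.1 hp).1
  have hdvd : ∀ (V : Finset ℕ), (∀ p ∈ V, p.Prime) → ∀ p : ℕ, p.Prime →
      (p ∣ ∏ r ∈ V, r ↔ p ∈ V) := by
    intro V hV p hp
    rw [hp.prime.dvd_finsetProd_iff]
    constructor
    · rintro ⟨r, hr, hpr⟩
      rwa [(Nat.prime_dvd_prime_iff_eq hp (hV r hr)).1 hpr]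
    · exact fun h => ⟨p, h, dvd_rfl⟩
  have hx0 : 0 < ∏ r ∈ S, r := Finset.prod_pos fun p hp => (hS p hp).pos
  have hy0 : 0 < ∏ r ∈ W, r := Finset.prod_pos fun p hp => (hW p hp).pos
  refine ⟨∏ r ∈ S, r, ∏ r ∈ W, r, hx0, hy0, ?_, ?_, ?_⟩
  · calc (∏ r ∈ S, r) * ∏ r ∈ W, r ≤ (∏ r ∈ U, r) * ∏ r ∈ W, r := by
          refine Nat.mul_le_mul_right _ (Finset.prod_le_prod_of_subset_of_one_le' ?_ ?_)
          · exact Finset.filter_subset _ _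
          · intro p hp _
            exact (Nat.prime_of_mem_primeFactors (Finset.mem_filter.1 hp).1).one_le
      _ = ∏ r ∈ D.primeFactors, r := Finset.prod_filter_mul_prod_filter_not _ _ _
      _ ≤ D := Nat.le_of_dvd (Nat.pos_of_ne_zero hD) (Nat.prod_primeFactors_dvd D)
  · refine Nat.coprime_of_dvd fun p hp h1 h2 => ?_
    rw [hdvd S hS p hp] at h1
    rw [hdvd W hW p hp] at h2
    exact (Finset.mem_filter.1 h2).2 (Finset.mem_filter.1 (Finset.mem_filter.1 h1).1).2
  · refine intGcd_eq_one_of_forall_prime fun p hp h1 h2 => ?_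
    have hpD : p ∈ D.primeFactors :=
      Nat.mem_primeFactors.2 ⟨hp, by exact_mod_cast h2, hD⟩
    have hpI := Nat.prime_iff_prime_int.1 hp
    have hpS := hdvd S hS p hp
    have hpW := hdvd W hW p hp
    rw [← Int.natCast_dvd_natCast] at hpS hpW
    generalize (∏ r ∈ S, r) = x at *
    generalize (∏ r ∈ W, r) = y at *
    simp only [eval] at h1
    by_cases hpa : (p : ℤ) ∣ f.a
    · have hyp : ¬ (p : ℤ) ∣ y := by
        rw [hpW]
        exact fun h => (Finset.mem_filter.1 h).2 hpa
      have hpU : p ∈ U := Finset.mem_filter.2 ⟨hpD, hpa⟩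
      by_cases hpc : (p : ℤ) ∣ f.c
      · have hxp : ¬ (p : ℤ) ∣ x := by
          rw [hpS]
          exact fun h => (Finset.mem_filter.1 h).2 hpc
        have h3 : (p : ℤ) ∣ f.b * x * y := by
          rwa [dvd_add_left (hpc.mul_right _), dvd_add_right (hpa.mul_right _)] at h1
        rcases hpI.dvd_or_dvd h3 with h3 | h3
        · rcases hpI.dvd_or_dvd h3 with h3 | h3
          · exact hf p hp hpa h3 hpc
          · exact hxp h3
        · exact hyp h3
      · have hxp : (p : ℤ) ∣ x := hpS.2 (Finset.mem_filter.2 ⟨hpU, hpc⟩)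
        have h3 : (p : ℤ) ∣ f.c * y ^ 2 := by
          rwa [dvd_add_right (((hpa.mul_right _)).add ((hxp.mul_left _).mul_right _))] at h1
        rcases hpI.dvd_or_dvd h3 with h3 | h3
        · exact hpc h3
        · exact hyp (hpI.dvd_of_dvd_pow h3)
    · have hyp : (p : ℤ) ∣ y := hpW.2 (Finset.mem_filter.2 ⟨hpD, hpa⟩)
      have hxp : ¬ (p : ℤ) ∣ x := by
        rw [hpS]
        exact fun h => hpa (Finset.mem_filter.1 (Finset.mem_filter.1 h).1).2
      have h3 : (p : ℤ) ∣ f.a * x ^ 2 := by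
        rwa [add_assoc, dvd_add_left ((hyp.mul_left _).add
          ((hyp.trans (dvd_pow_self _ two_ne_zero)).mul_left _))] at h1
      rcases hpI.dvd_or_dvd h3 with h3 | h3
      · exact hpa h3
      · exact hxp (hpI.dvd_of_dvd_pow h3)

theorem exists_small_coprime_value {f : BinaryForm ℤ} (ha : 0 < f.a) {Δ : ℤ} (hΔ : 0 < Δ)
    (hdisc : f.disc = -Δ)
    (hf : ∀ p : ℕ, p.Prime → (p : ℤ) ∣ f.a → (p : ℤ) ∣ f.b → (p : ℤ) ∣ f.c → False) :
    ∃ x y : ℤ, Int.gcd x y = 1 ∧ 0 < f.eval x y ∧ f.eval x y ≤ Δ ^ 3 ∧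
      Int.gcd (f.eval x y) Δ = 1 := by
  obtain ⟨s, t, u, v, hdet, g, hga, hgb, hgc, hgd, hg⟩ := exists_reduced ha (by omega)
  have hgprim : ∀ p : ℕ, p.Prime →
      (p : ℤ) ∣ g.a → (p : ℤ) ∣ g.b → (p : ℤ) ∣ g.c → False := by
    intro p hp h1 h2 h3
    have key : ∀ x y : ℤ, (p : ℤ) ∣ f.eval x y := by
      intro x y
      have h := hg (v * x - t * y) (-u * x + s * y)
      rw [show s * (v * x - t * y) + t * (-u * x + s * y) = x by linear_combination x * hdet,
        show u * (v * x - t * y) + v * (-u * x + s * y) = y by linear_combination y * hdet] at h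
      rw [← h]
      simp only [eval]
      exact ((h1.mul_right _).add ((h2.mul_right _).mul_right _)).add (h3.mul_right _)
    have k1 := key 1 0
    have k2 := key 0 1
    have k3 := key 1 1
    simp only [eval] at k1 k2 k3
    refine hf p hp (by simpa using k1) ?_ (by simpa using k2)
    have := (k3.sub k1).sub k2
    ring_nf at this
    exact this
  lift Δ to ℕ using hΔ.le
  obtain ⟨x, y, hx, hy, hxy, hcop, hco⟩ := exists_coprime_eval (D := Δ) (by omega) hgprim
  have hx' : (1 : ℤ) ≤ x := by exact_mod_cast hx
  have hy' : (1 : ℤ) ≤ y := by exact_mod_cast hy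
  have hxy' : (x : ℤ) * y ≤ Δ := by exact_mod_cast hxy
  have hgdisc : g.b ^ 2 - 4 * g.a * g.c = -Δ := hgd.trans hdisc
  have hb2 : g.b ^ 2 ≤ g.a * g.c := by
    rw [← sq_abs]
    nlinarith [abs_nonneg g.b]
  have hb := abs_le.1 hgb
  have hxx : g.a * x ^ 2 + g.b * x * y ≥ g.a * x * (x - y) := by
    linarith [mul_nonneg (by linarith : 0 ≤ g.b + g.a) (by positivity : (0 : ℤ) ≤ x * y)]
  refine ⟨s * x + t * y, u * x + v * y, ?_, ?_, ?_, ?_⟩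
  · obtain ⟨m, n, hmn⟩ := Nat.isCoprime_iff_coprime.2 hcop
    refine Int.isCoprime_iff_gcd_eq_one.1 ⟨m * v - n * u, -m * t + n * s, ?_⟩
    linear_combination hmn + (m * x + n * y) * hdet
  · rw [← hg]
    simp only [eval]
    have h1 : 0 < g.a * (x ^ 2 - x * y + y ^ 2) := by
      refine mul_pos hga ?_
      nlinarith [sq_nonneg ((x : ℤ) - y), mul_pos (zero_lt_one.trans_le hx') (zero_lt_one.trans_le hy')]
    linarith [mul_le_mul_of_nonneg_right hgc (sq_nonneg (y : ℤ))]
  · rw [← hg]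
    -- `Δ = 4ac - b² ≥ 3ac ≥ 3c`.
    have h3c : 3 * g.c ≤ Δ := by nlinarith
    have h1 : g.eval x y ≤ g.c * (x ^ 2 + x * y + y ^ 2) := by
      simp only [eval]
      have i1 := mul_le_mul_of_nonneg_right hgc (sq_nonneg (x : ℤ))
      have i2 := mul_le_mul_of_nonneg_right (hb.2.trans hgc) (by positivity : (0 : ℤ) ≤ x * y)
      linarith
    have h2 : (x : ℤ) ^ 2 + x * y + y ^ 2 ≤ Δ ^ 2 + Δ + 1 := by
      have : ((x : ℤ) ^ 2 - 1) * (y ^ 2 - 1) ≥ 0 := mul_nonneg (by nlinarith) (by nlinarith)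
      have : ((x : ℤ) * y) ^ 2 ≤ Δ ^ 2 := pow_le_pow_left₀ (by positivity) hxy' 2
      nlinarith
    have h3 : (Δ : ℤ) ^ 2 + Δ + 1 ≤ 3 * Δ ^ 2 := by nlinarith
    have h4 : 3 * g.eval x y ≤ Δ * (3 * Δ ^ 2) :=
      calc 3 * g.eval x y ≤ 3 * g.c * (x ^ 2 + x * y + y ^ 2) := by linarith
        _ ≤ Δ * (3 * Δ ^ 2) :=
          mul_le_mul h3c (h2.trans h3) (by positivity) (by positivity)
    have h5 : (Δ : ℤ) * (3 * Δ ^ 2) = 3 * Δ ^ 3 := by ring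
    linarith
  · rw [← hg]
    exact hco

end BinaryForm

/-! ### The square identity and the conclusion. -/

open BinaryForm in
theorem propositionp (q : BinaryForm ℤ) (Δ : ℤ) (hprim : q.IsPrimitive) (hpos : q.PosDef)
    (hdisc : q.disc = -Δ) (hgenus : q.InPrincipalGenus) :
    ∃ N : ℤ, 0 < N ∧ N ≤ Δ ^ 3 ∧ Int.gcd N Δ = 1 ∧ q.PrimitivelyRepresents (N ^ 2) := by
  have hΔ : 0 < Δ := by linarith [hpos.disc_neg]
  have hdisc' : 4 * q.a * q.c - q.b ^ 2 = Δ := by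
    simp only [disc] at hdisc
    linarith
  obtain ⟨u, v, huv⟩ := exists_eval_one_modEq hgenus (Int.natAbs_pos.2 hΔ.ne').ne'
  obtain ⟨A₁, B₁, C₁, A₂, B₂, C₂, ha, hb, hc, l, m, n, hlmn⟩ :=
    exists_representation_of_one_mod_disc (u := u) (v := v) hpos.a_pos (hdisc' ▸ hΔ) (by
      rw [hdisc', ← Int.natAbs_dvd]
      exact huv)
  obtain ⟨f, hf⟩ : ∃ f : BinaryForm ℤ,
    f = ⟨A₁ * B₂ - A₂ * B₁, A₁ * C₂ - A₂ * C₁, B₁ * C₂ - B₂ * C₁⟩ := ⟨_, rfl⟩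
  have hfdisc : f.disc = -Δ := by
    rw [← hdisc', ha, hb, hc, hf]
    simp only [disc]
    ring
  have hfprim : ∀ p : ℕ, p.Prime →
      (p : ℤ) ∣ f.a → (p : ℤ) ∣ f.b → (p : ℤ) ∣ f.c → False := by
    intro p hp h1 h2 h3
    refine (Nat.prime_iff_prime_int.1 hp).not_dvd_one ?_
    rw [← hlmn]
    rw [hf] at h1 h2 h3
    exact ((h1.mul_left _).add (h2.mul_left _)).add (h3.mul_left _)
  obtain ⟨x, y, hxy, hne, hle, hco⟩ : ∃ x y : ℤ, Int.gcd x y = 1 ∧ 0 < |f.eval x y| ∧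
      |f.eval x y| ≤ Δ ^ 3 ∧ Int.gcd (f.eval x y) Δ = 1 := by
    -- Negative discriminant makes `f` definite, but of either sign.
    rcases lt_trichotomy f.a 0 with h | h | h
    · obtain ⟨x, y, h1, h2, h3, h4⟩ := exists_small_coprime_value (f := ⟨-f.a, -f.b, -f.c⟩)
        (by simpa using h) hΔ (by rw [← hfdisc]; simp only [disc]; ring)
        (fun p hp k1 k2 k3 => hfprim p hp (by simpa using k1) (by simpa using k2)
          (by simpa using k3))
      have hneg : (BinaryForm.mk (-f.a) (-f.b) (-f.c)).eval x y = -f.eval x y := by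
        simp only [eval]
        ring
      rw [hneg] at h2 h3 h4
      rw [Int.neg_gcd] at h4
      exact ⟨x, y, h1, by rwa [abs_of_neg (by linarith)], by rwa [abs_of_neg (by linarith)], h4⟩
    · simp only [disc, h] at hfdisc
      nlinarith [sq_nonneg f.b]
    · obtain ⟨x, y, h1, h2, h3, h4⟩ := exists_small_coprime_value h hΔ hfdisc hfprim
      exact ⟨x, y, h1, by rwa [abs_of_pos h2], by rwa [abs_of_pos h2], h4⟩
  refine ⟨|f.eval x y|, hne, hle, by rwa [Int.gcd, Int.natAbs_abs], A₂ * x ^ 2 + 2 * B₂ * x * y + C₂ * y ^ 2,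
    -(A₁ * x ^ 2 + 2 * B₁ * x * y + C₁ * y ^ 2), ?_, ?_⟩
  · refine intGcd_eq_one_of_forall_prime fun p hp h1 h2 => ?_
    rw [dvd_neg] at h2
    have hpI := Nat.prime_iff_prime_int.1 hp
    have hpf : (p : ℤ) ∣ f.eval x y := by
      have e : f.eval x y ^ 2 = q.eval (A₂ * x ^ 2 + 2 * B₂ * x * y + C₂ * y ^ 2)
          (-(A₁ * x ^ 2 + 2 * B₁ * x * y + C₁ * y ^ 2)) := by
        simp only [eval, ha, hb, hc, hf]
        ring
      refine hpI.dvd_of_dvd_pow (n := 2) ?_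
      rw [e]
      simp only [eval]
      exact (((h1.trans (dvd_pow_self _ two_ne_zero)).mul_left _).add
        ((h1.mul_left _).mul_right _)).add
        ((((dvd_neg.2 h2)).trans (dvd_pow_self _ two_ne_zero)).mul_left _)
    have hpΔ : ¬ (p : ℤ) ∣ Δ := by
      intro h
      have := Int.dvd_coe_gcd hpf h
      rw [hco] at this
      exact hpI.not_dvd_one this
    obtain ⟨k₂, hk₂⟩ := h1
    obtain ⟨k₁, hk₁⟩ := h2
    have hfa : f.a = A₁ * B₂ - A₂ * B₁ := by rw [hf]
    have hfb : f.b = A₁ * C₂ - A₂ * C₁ := by rw [hf]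
    have hfc : f.c = B₁ * C₂ - B₂ * C₁ := by rw [hf]
    have hΔf : Δ = 4 * f.a * f.c - f.b ^ 2 := by
      simp only [disc] at hfdisc
      linarith
    -- The resultant of `Q₁` and `Q₂` is `disc f = -Δ`. Eliminating one coefficient at a time shows
    -- that a common prime divisor of their values at `(x, y)` divides `Δ x³` and `Δ y³`.
    have i₁ : x * (f.b * x + 2 * f.c * y) = p * (C₂ * k₁ - C₁ * k₂) := by
      rw [hfb, hfc]
      linear_combination C₂ * hk₁ - C₁ * hk₂
    have i₂ : y * (2 * f.a * x + f.b * y) = p * (A₁ * k₂ - A₂ * k₁) := by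
      rw [hfb, hfa]
      linear_combination A₁ * hk₂ - A₂ * hk₁
    have i₃ : f.a * x ^ 2 - f.c * y ^ 2 = p * (B₂ * k₁ - B₁ * k₂) := by
      rw [hfa, hfc]
      linear_combination B₂ * hk₁ - B₁ * hk₂
    have hx : (p : ℤ) ∣ Δ * x ^ 3 :=
      ⟨(-f.b * x + 2 * f.c * y) * (C₂ * k₁ - C₁ * k₂) + 4 * f.c * x * (B₂ * k₁ - B₁ * k₂), by
        rw [hΔf]
        linear_combination (-f.b * x + 2 * f.c * y) * i₁ + 4 * f.c * x * i₃⟩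
    have hy : (p : ℤ) ∣ Δ * y ^ 3 :=
      ⟨(-f.b * y + 2 * f.a * x) * (A₁ * k₂ - A₂ * k₁) - 4 * f.a * y * (B₂ * k₁ - B₁ * k₂), by
        rw [hΔf]
        linear_combination (-f.b * y + 2 * f.a * x) * i₂ - 4 * f.a * y * i₃⟩
    have := Int.dvd_coe_gcd (hpI.dvd_of_dvd_pow ((hpI.dvd_or_dvd hx).resolve_left hpΔ))
      (hpI.dvd_of_dvd_pow ((hpI.dvd_or_dvd hy).resolve_left hpΔ))
    rw [hxy] at this
    exact hpI.not_dvd_one this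
  · rw [sq_abs]
    simp only [eval, ha, hb, hc, hf]
    ring
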